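/- Let $G$ be an abelian, non-compact, second countable, locally compact (Hausdorff) group with Haar measure $\mu$, and let $1\leqslant p<\infty$. A weight on $G$ is a measurable strictly positive function $\omega:G\to\mathbb{R}$ which is $p$-summable on every compact subset of $G$; the weighted space is $L^p(G,\omega)=\{f:G\to\mathbb{C} \;:\; \|f\|_{p,\omega}=(\int_G|f\omega|^p\,d\mu)^{1/p}<\infty\}$ (measurable functions modulo equality $\mu$-almost everywhere), and $(T_sf)(t)=f(s^{-1}t)$ for $s,t\in G$. Let $\omega$ be a continuous weight which is $G$-admissible, that is, for every $s\in G$ the translation $T_s$ is a bounded operator from $L^p(G,\omega)$ to itself. Let $S\subset G$ be any subset. Then there is an $S$-dense vector in $L^p(G,\omega)$, that is, an $f\in L^p(G,\omega)$ such that $\{T_sf: s\in S\}$ is dense in $L^p(G,\omega)$, if and only if $$\inf_{s\in S}\max\big(\omega(s),\omega(s^{-1})\big)=0,$$ where $\inf\emptyset=+\infty$. -/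

import Mathlib

open MeasureTheory
open scoped ENNReal NNReal

namespace WeightedLp

variable {G : Type*} [Group G] [TopologicalSpace G] [MeasurableSpace G]

/-- A weight on `G` (for the exponent `p` and the Haar measure `μ`): a measurable, strictly
positive function which is `p`-summable on every compact set. -/
structure IsWeight (μ : Measure G) (p : ℝ≥0∞) (ω : G → ℝ) : Prop where
  measurable : Measurable ω
  pos : ∀ t, 0 < ω t
  locally_summable : ∀ K : Set G, IsCompact K → MemLp ω p (μ.restrict K)

/-- `f` belongs to `L^p(G, ω)`, that is, `f ω` belongs to `L^p(G)`. -/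
def Mem (μ : Measure G) (p : ℝ≥0∞) (ω : G → ℝ) (f : G → ℂ) : Prop :=
  MemLp (fun t => f t * (ω t : ℂ)) p μ

/-- The weighted norm `‖f‖_{p,ω} = (∫ |f ω|^p dμ)^{1/p}`, with values in `[0, ∞]`. -/
noncomputable def wnorm (μ : Measure G) (p : ℝ≥0∞) (ω : G → ℝ) (f : G → ℂ) : ℝ≥0∞ :=
  eLpNorm (fun t => f t * (ω t : ℂ)) p μ

/-- Left translation, `(T_s f)(t) = f (s⁻¹ t)`. -/
def leftTranslate (s : G) (f : G → ℂ) : G → ℂ := fun t => f (s⁻¹ * t)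

/-- `ω` is `S`-admissible: for every `s ∈ S` the operator `T_s` maps `L^p(G, ω)` to itself and is
bounded there. -/
def IsAdmissible (μ : Measure G) (p : ℝ≥0∞) (ω : G → ℝ) (S : Set G) : Prop :=
  ∀ s ∈ S, ∃ C : ℝ≥0, ∀ f : G → ℂ, Mem μ p ω f →
    Mem μ p ω (leftTranslate s f) ∧ wnorm μ p ω (leftTranslate s f) ≤ C * wnorm μ p ω f

/-- `f` is an `S`-dense vector of `L^p(G, ω)`: it lies in this space, and its orbit
`{T_s f : s ∈ S}` is dense there, that is, every `g` in the space is a limit in the weighted norm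
of elements of the orbit.  Functions stand for their classes modulo equality almost everywhere;
as `ω > 0`, two functions are in the same class iff their difference has weighted norm `0`. -/
def IsDenseVector (μ : Measure G) (p : ℝ≥0∞) (ω : G → ℝ) (S : Set G) (f : G → ℂ) : Prop :=
  Mem μ p ω f ∧ ∀ g : G → ℂ, Mem μ p ω g → ∀ ε : ℝ≥0∞, 0 < ε →
    ∃ s ∈ S, wnorm μ p ω (leftTranslate s f - g) < ε

end WeightedLp

/-! Testing `T_s` on indicators of small compact neighbourhoods gives `ω (s * t) ≤ C * ω t` for all
`t` (`exists_forall_mul_le`); Baire's theorem makes `C` uniform for `s` in a compact set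
(`exists_forall_mem_mul_le`). Hence `ω (s * u)` is comparable to `ω s` for `u` in a compact set.

Sufficiency: if `ω s` and `ω s⁻¹` are small, then `T_s f` and `T_{s⁻¹} g` are small for compactly
supported `f`, `g`. So `f + T_{s⁻¹} g` is near `f` and its translate `T_s f + g` is near `g`. This
is topological transitivity, and Birkhoff's theorem gives a dense orbit.

Necessity: take a dense vector `f` near `1_K` and `s ∈ S` with `T_s f` near `c 1_K`. A large `c`
forces `s K` to be disjoint from `K`. Then `T_s f` is nearly `0` on `s K`, although it is a
translate of a function near `1` on `K`, so `ω s` is small; exchanging `f` and `T_s f` bounds `ω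
s⁻¹` (`weight_mul_le`). -/

namespace WeightedLp

open Set Filter Topology

/-! ### Translation operators -/

section Algebra

variable {G : Type*} [CommGroup G]

lemma leftTranslate_leftTranslate (s t : G) (f : G → ℂ) :
    leftTranslate s (leftTranslate t f) = leftTranslate (s * t) f := by
  funext x
  simp [leftTranslate, mul_assoc, mul_comm]

lemma leftTranslate_one (f : G → ℂ) : leftTranslate 1 f = f := by
  funext x
  simp [leftTranslate]

lemma leftTranslate_sub (s : G) (f g : G → ℂ) :
    leftTranslate s (f - g) = leftTranslate s f - leftTranslate s g := rfl

end Algebra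

/-! ### The weighted space and its norm -/

section Norm

variable {G : Type*} [MeasurableSpace G] {μ : Measure G} {p : ℝ≥0∞} {ω : G → ℝ} {f g : G → ℂ}

lemma Mem.aestronglyMeasurable (hω : Measurable ω) (hpos : ∀ t, 0 < ω t) (hf : Mem μ p ω f) :
    AEStronglyMeasurable f μ := by
  have h : AEStronglyMeasurable (fun t => ((ω t)⁻¹ : ℂ)) μ :=
    (Complex.measurable_ofReal.comp hω).inv.aestronglyMeasurable
  refine (hf.1.mul h).congr (.of_forall fun t => ?_)
  have : (ω t : ℂ) ≠ 0 := by exact_mod_cast (hpos t).ne'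
  simp [this]

lemma Mem.sub (hf : Mem μ p ω f) (hg : Mem μ p ω g) : Mem μ p ω (f - g) := by
  refine (MemLp.sub hf hg).ae_eq (.of_forall fun t => ?_)
  simp [sub_mul]

lemma Mem.add (hf : Mem μ p ω f) (hg : Mem μ p ω g) : Mem μ p ω (f + g) := by
  refine (MemLp.add hf hg).ae_eq (.of_forall fun t => ?_)
  simp [add_mul]

lemma wnorm_add_le (hp : 1 ≤ p) (hf : Mem μ p ω f) (hg : Mem μ p ω g) :
    wnorm μ p ω (f + g) ≤ wnorm μ p ω f + wnorm μ p ω g := by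
  refine le_trans (le_of_eq ?_) (eLpNorm_add_le hf.1 hg.1 hp)
  unfold wnorm
  congr 1
  funext t
  simp [add_mul]

lemma wnorm_sub_comm (f g : G → ℂ) : wnorm μ p ω (f - g) = wnorm μ p ω (g - f) := by
  unfold wnorm
  rw [← eLpNorm_neg]
  congr 1
  funext t
  simp only [Pi.neg_apply, Pi.sub_apply]
  ring

lemma wnorm_indicator_const (K : Set G) (c : ℂ) :
    wnorm μ p ω (K.indicator fun _ => c) = ‖c‖ₑ * wnorm μ p ω (K.indicator fun _ => 1) := by
  rw [wnorm, wnorm, ← eLpNorm_const_smul]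
  congr 1
  funext t
  by_cases ht : t ∈ K <;> simp [ht]

/-- The indicator function of a compact set lies in the weighted space. -/
lemma IsWeight.mem_indicator [TopologicalSpace G] (hω : IsWeight μ p ω) {K : Set G}
    (hK : IsCompact K) (hKm : MeasurableSet K) (c : ℂ) :
    Mem μ p ω (K.indicator fun _ => c) := by
  have h : MemLp (fun t => c * (ω t : ℂ)) p (μ.restrict K) :=
    ((hω.locally_summable K hK).ofReal (K := ℂ)).const_mul c
  refine (memLp_indicator_iff_restrict hKm).2 h |>.ae_eq (.of_forall fun t => ?_)
  by_cases ht : t ∈ K <;> simp [ht]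

lemma IsWeight.wnorm_indicator_ne_zero [TopologicalSpace G] (hp : p ≠ 0) (hω : IsWeight μ p ω)
    {K : Set G} (hK : IsCompact K) (hKm : MeasurableSet K) (hK0 : μ K ≠ 0) :
    wnorm μ p ω (K.indicator fun _ => 1) ≠ 0 := by
  intro h0
  have := (eLpNorm_eq_zero_iff (hω.mem_indicator hK hKm 1).1 hp).1 h0
  refine hK0 (measure_mono_null (fun t ht => ?_) (ae_iff.1 this))
  simpa [ht] using (hω.pos t).ne'

end Norm

/-! ### Translation bounds and the weight -/

section Translation

variable {G : Type*} [CommGroup G] [TopologicalSpace G] [IsTopologicalGroup G]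
  [MeasurableSpace G] [BorelSpace G]
  {μ : Measure G} {p : ℝ≥0∞} {ω : G → ℝ} {s : G}

/-- Invariance of `μ` moves the translation from `f` to the weight, so norm estimates reduce to
pointwise bounds on `ω (s * u)`. -/
lemma wnorm_leftTranslate [μ.IsMulLeftInvariant] (s : G) (f : G → ℂ) :
    wnorm μ p ω (leftTranslate s f) = eLpNorm (fun u => f u * (ω (s * u) : ℂ)) p μ := by
  have h := (measurableEmbedding_mulLeft s).eLpNorm_map_measure (μ := μ) (p := p)
    (g := fun t => leftTranslate s f t * (ω t : ℂ))
  rw [map_mul_left_eq_self] at h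
  rw [wnorm, h]
  congr 1
  funext u
  simp [leftTranslate]

lemma wnorm_leftTranslate_le [μ.IsMulLeftInvariant] {C : ℝ} (hpos : ∀ t, 0 < ω t)
    (hC : ∀ t, ω (s * t) ≤ C * ω t) (f : G → ℂ) :
    wnorm μ p ω (leftTranslate s f) ≤ ENNReal.ofReal C * wnorm μ p ω f := by
  rw [wnorm_leftTranslate]
  refine eLpNorm_le_mul_eLpNorm_of_ae_le_mul (.of_forall fun t => ?_) p
  simp only [norm_mul, Complex.norm_real, Real.norm_of_nonneg (hpos _).le]
  nlinarith [norm_nonneg (f t), hC t]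

/-- A bounded translation operator yields a pointwise bound for a continuous weight. -/
lemma exists_forall_mul_le [LocallyCompactSpace G] [T2Space G] [μ.IsHaarMeasure]
    (hp : 1 ≤ p) (hω : IsWeight μ p ω) (hcont : Continuous ω)
    (hadm : IsAdmissible μ p ω univ) (s : G) : ∃ C : ℝ, ∀ t, ω (s * t) ≤ C * ω t := by
  obtain ⟨C, hC⟩ := hadm s (mem_univ s)
  refine ⟨C, fun t₀ => ?_⟩
  by_contra! hlt
  -- The strict gap `C < D` contradicts the operator bound once `T_s` is tested on the indicator of
  -- a compact `K` where `D * ω t < ω (s * t)`.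
  obtain ⟨D, hCD, hD⟩ : ∃ D : ℝ, (C : ℝ) < D ∧ D * ω t₀ < ω (s * t₀) := by
    obtain ⟨D, h1, h2⟩ := exists_between ((lt_div_iff₀ (hω.pos t₀)).2 hlt)
    exact ⟨D, h1, (lt_div_iff₀ (hω.pos t₀)).1 h2⟩
  have hU : {t | D * ω t < ω (s * t)} ∈ 𝓝 t₀ :=
    (isOpen_lt (by fun_prop) (by fun_prop)).mem_nhds hD
  obtain ⟨K, hK, hKU, hKc⟩ := local_compact_nhds hU
  have hKm : MeasurableSet K := hKc.isClosed.measurableSet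
  have hmem := hω.mem_indicator hKc hKm 1
  have h1 := (hC _ hmem).2
  set w := wnorm μ p ω (K.indicator fun _ => (1 : ℂ)) with hw
  have h2 : ENNReal.ofReal D * w ≤ wnorm μ p ω (leftTranslate s (K.indicator fun _ => (1 : ℂ))) := by
    have hD0 : 0 ≤ D := C.2.trans hCD.le
    rw [wnorm_leftTranslate, hw, wnorm, ← Real.enorm_of_nonneg hD0, ← eLpNorm_const_smul]
    refine eLpNorm_mono fun t => ?_
    by_cases ht : t ∈ K
    · have := (hKU ht : D * ω t < ω (s * t))
      simpa [ht, abs_of_pos (hω.pos _), abs_of_nonneg hD0] using this.le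
    · simp [ht]
  have hw_top : w ≠ ∞ := hmem.2.ne
  have hw0 : w ≠ 0 := hω.wnorm_indicator_ne_zero (zero_lt_one.trans_le hp).ne' hKc hKm
    (Measure.measure_pos_of_mem_nhds μ hK).ne'
  have h3 := (ENNReal.mul_le_mul_iff_left hw0 hw_top).1 (h2.trans h1)
  rw [ENNReal.ofReal_le_iff_le_toReal ENNReal.coe_ne_top] at h3
  exact absurd hCD (not_lt.2 h3)

end Translation

/-! ### Uniform growth on compact sets, by Baire -/

section Growth

variable {G : Type*} [CommGroup G] [TopologicalSpace G] [IsTopologicalGroup G] {ω : G → ℝ}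

/-- A continuous weight whose translation growth is pointwise finite has locally bounded growth. -/
lemma exists_forall_mem_mul_le [BaireSpace G] (hpos : ∀ t, 0 < ω t) (hcont : Continuous ω)
    (hbdd : ∀ s, ∃ C : ℝ, ∀ t, ω (s * t) ≤ C * ω t) {K : Set G} (hK : IsCompact K) :
    ∃ C : ℝ, 0 < C ∧ ∀ s ∈ K, ∀ t, ω (s * t) ≤ C * ω t := by
  obtain ⟨n, s₀, hs₀⟩ : ∃ n : ℕ, (interior {s | ∀ t, ω (s * t) ≤ n * ω t}).Nonempty := by
    refine nonempty_interior_of_iUnion_of_closed (fun n => ?_) (eq_univ_of_forall fun s => ?_)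
    · simp only [ofPred_forall]
      exact isClosed_iInter fun t => isClosed_le (by fun_prop) (by fun_prop)
    · obtain ⟨C, hC⟩ := hbdd s
      obtain ⟨n, hn⟩ := exists_nat_ge C
      exact mem_iUnion.2 ⟨n, fun t => (hC t).trans
        (mul_le_mul_of_nonneg_right hn (hpos t).le)⟩
  refine hK.induction_on (p := fun K => ∃ C : ℝ, 0 < C ∧ ∀ s ∈ K, ∀ t, ω (s * t) ≤ C * ω t)
    ⟨1, one_pos, by simp⟩ ?_ ?_ ?_
  · rintro A B hAB ⟨C, hC, h⟩
    exact ⟨C, hC, fun s hs => h s (hAB hs)⟩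
  · rintro A B ⟨C, hC, h⟩ ⟨D, hD, h'⟩
    refine ⟨max C D, lt_max_of_lt_left hC, ?_⟩
    rintro s (hs | hs) t
    · exact (h s hs t).trans (mul_le_mul_of_nonneg_right (le_max_left _ _) (hpos t).le)
    · exact (h' s hs t).trans (mul_le_mul_of_nonneg_right (le_max_right _ _) (hpos t).le)
  -- Write `x = (k * s₀⁻¹) * (s₀ * k⁻¹ * x)`: for `x` near `k` the second factor is near `s₀`, where
  -- the bound `n` holds.
  · intro k _
    obtain ⟨C, hC⟩ := hbdd (k * s₀⁻¹)
    have hC0 : 0 < C := pos_of_mul_pos_left ((hpos _).trans_le (hC 1)) (hpos 1).le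
    have hnhds : ∀ᶠ x in 𝓝 k, s₀ * k⁻¹ * x ∈ {s | ∀ t, ω (s * t) ≤ n * ω t} := by
      have hc : Tendsto (fun x => s₀ * k⁻¹ * x) (𝓝 k) (𝓝 s₀) := by
        have : Continuous fun x => s₀ * k⁻¹ * x := by fun_prop
        simpa using this.tendsto k
      exact hc (mem_interior_iff_mem_nhds.1 hs₀)
    refine ⟨_, mem_nhdsWithin_of_mem_nhds hnhds, C * (n + 1), by positivity, fun x hx t => ?_⟩
    have h1 := hC (s₀ * k⁻¹ * x * t)
    have h2 : ω (s₀ * k⁻¹ * x * t) ≤ n * ω t := hx t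
    rw [show k * s₀⁻¹ * (s₀ * k⁻¹ * x * t) = x * t by group] at h1
    nlinarith [hpos t, mul_le_mul_of_nonneg_left h2 hC0.le]

end Growth

/-! ### Small weights give a dense orbit -/

section Sufficiency

/-- Birkhoff transitivity: a topologically transitive family of continuous self-maps of a
second countable Baire space has a point with dense orbit. -/
lemma exists_forall_isOpen_exists_mem {ι X : Type*} [TopologicalSpace X] [BaireSpace X]
    [SecondCountableTopology X] [Nonempty X] {A : ι → X → X} {S : Set ι}
    (hA : ∀ i ∈ S, Continuous (A i))
    (htrans : ∀ U V : Set X, IsOpen U → IsOpen V → U.Nonempty → V.Nonempty →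
      ∃ i ∈ S, ∃ x ∈ U, A i x ∈ V) :
    ∃ x, ∀ V : Set X, IsOpen V → V.Nonempty → ∃ i ∈ S, A i x ∈ V := by
  open TopologicalSpace in
  obtain ⟨x, hx⟩ : (⋂ V ∈ countableBasis X, ⋃ i ∈ S, A i ⁻¹' V).Nonempty := by
    refine (dense_biInter_of_isOpen (fun V hV => ?_) (countable_countableBasis X)
      fun V hV => ?_).nonempty
    · exact isOpen_biUnion fun i hi => (isOpen_of_mem_countableBasis hV).preimage (hA i hi)
    · refine dense_iff_inter_open.2 fun U hU hUne => ?_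
      obtain ⟨i, hi, x, hxU, hxV⟩ := htrans U V hU (isOpen_of_mem_countableBasis hV) hUne
        (nonempty_of_mem_countableBasis hV)
      exact ⟨x, hxU, mem_biUnion hi hxV⟩
  refine ⟨x, fun V hV ⟨y, hy⟩ => ?_⟩
  obtain ⟨W, hW, -, hWV⟩ :=
    (TopologicalSpace.isBasis_countableBasis X).exists_subset_of_mem_open hy hV
  obtain ⟨i, hi, hxi⟩ := mem_iUnion₂.1 (mem_iInter₂.1 hx W hW)
  exact ⟨i, hi, hWV hxi⟩

variable {G : Type*} [MeasurableSpace G] {μ : Measure G} {p : ℝ≥0∞} {ω : G → ℝ} {f g : G → ℂ}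

/-- The class of `f ω` in the unweighted space. -/
noncomputable def Mem.toLp (hf : Mem μ p ω f) : Lp ℂ p μ :=
  MemLp.toLp (fun t => f t * (ω t : ℂ)) hf

lemma Mem.edist_toLp (hf : Mem μ p ω f) (hg : Mem μ p ω g) :
    edist hf.toLp hg.toLp = wnorm μ p ω (f - g) := by
  refine (Lp.edist_toLp_toLp _ _ hf hg).trans ?_
  rw [wnorm]
  congr 1
  funext t
  simp [sub_mul]

lemma mem_div (hpos : ∀ t, 0 < ω t) {F : G → ℂ} (hF : MemLp F p μ) :
    Mem μ p ω fun t => F t / ω t :=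
  hF.ae_eq (.of_forall fun t => by
    have : (ω t : ℂ) ≠ 0 := by exact_mod_cast (hpos t).ne'
    simp [this])

/-- Division by `ω` inverts `f ↦ f ω`, so the weighted space is a copy of the whole of `Lp`, where
Birkhoff's theorem applies. -/
lemma toLp_div (hpos : ∀ t, 0 < ω t) (F : Lp ℂ p μ) :
    (mem_div hpos (Lp.memLp F)).toLp = F := by
  refine Lp.ext ((MemLp.coeFn_toLp _).trans (.of_forall fun t => ?_))
  have : (ω t : ℂ) ≠ 0 := by exact_mod_cast (hpos t).ne'
  simp [this]

variable [CommGroup G]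

/-- Translation on the weighted space, transported to the unweighted space. -/
noncomputable def lpTranslate (hpos : ∀ t, 0 < ω t) (hadm : IsAdmissible μ p ω univ) (s : G)
    (F : Lp ℂ p μ) : Lp ℂ p μ :=
  ((hadm s (mem_univ s)).choose_spec _ (mem_div hpos (Lp.memLp F))).1.toLp

lemma edist_lpTranslate_toLp (hpos : ∀ t, 0 < ω t) (hadm : IsAdmissible μ p ω univ) (s : G)
    (F : Lp ℂ p μ) (hg : Mem μ p ω g) :
    edist (lpTranslate hpos hadm s F) hg.toLp =
      wnorm μ p ω (leftTranslate s (fun t => F t / ω t) - g) :=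
  Mem.edist_toLp _ _

/-- Leaving the representative `f` free serves twice: it shows that `lpTranslate` does not depend on
the chosen representative, and that it is Lipschitz. -/
lemma exists_edist_lpTranslate_le (hpos : ∀ t, 0 < ω t) (hadm : IsAdmissible μ p ω univ)
    (s : G) : ∃ C : ℝ≥0, ∀ (F : Lp ℂ p μ) (f : G → ℂ) (hf : Mem μ p ω f)
      (hf' : Mem μ p ω (leftTranslate s f)),
      edist (lpTranslate hpos hadm s F) hf'.toLp ≤ C * edist F hf.toLp := by
  obtain ⟨C, hC⟩ := hadm s (mem_univ s)
  refine ⟨C, fun F f hf hf' => ?_⟩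
  have hF := mem_div hpos (Lp.memLp F)
  rw [edist_lpTranslate_toLp, ← leftTranslate_sub,
    show edist F hf.toLp = edist hF.toLp hf.toLp by rw [toLp_div hpos], Mem.edist_toLp]
  exact (hC _ (hF.sub hf)).2

lemma lpTranslate_toLp [Fact (1 ≤ p)] (hpos : ∀ t, 0 < ω t) (hadm : IsAdmissible μ p ω univ)
    (s : G) (hf : Mem μ p ω f) (hf' : Mem μ p ω (leftTranslate s f)) :
    lpTranslate hpos hadm s hf.toLp = hf'.toLp := by
  obtain ⟨C, hC⟩ := exists_edist_lpTranslate_le hpos hadm s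
  simpa using hC hf.toLp f hf hf'

lemma continuous_lpTranslate [Fact (1 ≤ p)] (hpos : ∀ t, 0 < ω t)
    (hadm : IsAdmissible μ p ω univ) (s : G) : Continuous (lpTranslate hpos hadm s) := by
  obtain ⟨C, hC⟩ := exists_edist_lpTranslate_le hpos hadm s
  refine LipschitzWith.continuous (K := C) fun F H => ?_
  have h := hC F _ (mem_div hpos (Lp.memLp H))
    ((hadm s (mem_univ s)).choose_spec _ (mem_div hpos (Lp.memLp H))).1
  rwa [toLp_div hpos] at h

variable [TopologicalSpace G] [IsTopologicalGroup G] [BorelSpace G]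

/-- If `max (ω s) (ω s⁻¹)` is arbitrarily small on `S`, translations by elements of `S` and their
inverses make compactly supported functions arbitrarily small simultaneously. -/
lemma exists_wnorm_leftTranslate_lt [μ.IsHaarMeasure]
    (hpos : ∀ t, 0 < ω t)
    (hgrowth : ∀ K : Set G, IsCompact K → ∃ C : ℝ, 0 < C ∧ ∀ s ∈ K, ∀ t, ω (s * t) ≤ C * ω t)
    {S : Set G} (hS : ∀ ε > 0, ∃ s ∈ S, ω s < ε ∧ ω s⁻¹ < ε)
    (hf : MemLp f p μ) (hfc : HasCompactSupport f) (hg : MemLp g p μ) (hgc : HasCompactSupport g)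
    {ε : ℝ≥0∞} (hε : 0 < ε) :
    ∃ s ∈ S, wnorm μ p ω (leftTranslate s f) < ε ∧ wnorm μ p ω (leftTranslate s⁻¹ g) < ε := by
  obtain ⟨C, hC0, hC⟩ := hgrowth _ (hfc.union hgc)
  -- By commutativity `ω (s * u) = ω (u * s) ≤ C * ω s` on the support, which leaves an unweighted
  -- norm of `h`.
  have key : ∀ {h : G → ℂ}, tsupport h ⊆ tsupport f ∪ tsupport g → ∀ s : G,
      wnorm μ p ω (leftTranslate s h) ≤ ENNReal.ofReal (ω s) *
        (ENNReal.ofReal C * eLpNorm h p μ) := by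
    intro h hh s
    rw [wnorm_leftTranslate, ← mul_assoc, ← ENNReal.ofReal_mul (hpos s).le]
    refine eLpNorm_le_mul_eLpNorm_of_ae_le_mul (.of_forall fun u => ?_) p
    by_cases hu : h u = 0
    · simp [hu]
    · have := hC u (hh (subset_tsupport h hu)) s
      rw [norm_mul, Complex.norm_real, Real.norm_of_nonneg (hpos _).le, mul_comm s u]
      nlinarith [norm_nonneg (h u)]
  obtain ⟨η, hη, hlt⟩ := ENNReal.exists_nnreal_pos_mul_lt
    (a := ENNReal.ofReal C * max (eLpNorm f p μ) (eLpNorm g p μ))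
    (ENNReal.mul_ne_top ENNReal.ofReal_ne_top (max_lt hf.2 hg.2).ne) hε.ne'
  obtain ⟨s, hs, h1, h2⟩ := hS η (by exact_mod_cast hη)
  have h1' : ENNReal.ofReal (ω s) ≤ η := by
    simpa using ENNReal.ofReal_le_ofReal h1.le
  have h2' : ENNReal.ofReal (ω s⁻¹) ≤ η := by
    simpa using ENNReal.ofReal_le_ofReal h2.le
  refine ⟨s, hs, (key subset_union_left s).trans_lt (lt_of_le_of_lt ?_ hlt),
    (key subset_union_right s⁻¹).trans_lt (lt_of_le_of_lt ?_ hlt)⟩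
  · gcongr
    exact le_max_left _ _
  · gcongr
    exact le_max_right _ _

theorem exists_isDenseVector [T2Space G] [LocallyCompactSpace G] [SecondCountableTopology G]
    [μ.IsHaarMeasure] (hp : 1 ≤ p) (hp_top : p ≠ ∞)
    (hω : IsWeight μ p ω) (hcont : Continuous ω) (hadm : IsAdmissible μ p ω univ)
    {S : Set G} (hS : ∀ ε > 0, ∃ s ∈ S, ω s < ε ∧ ω s⁻¹ < ε) :
    ∃ f : G → ℂ, IsDenseVector μ p ω S f := by
  have : Fact (1 ≤ p) := ⟨hp⟩
  have : Fact (p ≠ ∞) := ⟨hp_top⟩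
  have hgrowth := fun (K : Set G) (hK : IsCompact K) => exists_forall_mem_mul_le hω.pos hcont
    (exists_forall_mul_le hp hω hcont hadm) hK
  have hT : ∀ {s : G} {f : G → ℂ}, Mem μ p ω f → Mem μ p ω (leftTranslate s f) := by
    intro s f hf
    exact ((hadm s (mem_univ s)).choose_spec f hf).1
  -- Dividing a continuous compactly supported approximation by the continuous `ω` gives an `f`
  -- lying in both the weighted and the unweighted space.
  have approx : ∀ (F : Lp ℂ p μ) {ε : ℝ≥0∞}, 0 < ε → ∃ (f : G → ℂ) (hf : Mem μ p ω f),
      MemLp f p μ ∧ HasCompactSupport f ∧ edist hf.toLp F ≤ ε := by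
    intro F ε hε
    obtain ⟨F', hF'c, hle, hF'cont, hF'⟩ :=
      (Lp.memLp F).exists_hasCompactSupport_eLpNorm_sub_le hp_top hε.ne'
    have hf := mem_div hω.pos hF'
    have hsupp : HasCompactSupport fun t => F' t / (ω t : ℂ) :=
      hF'c.mono fun t ht => by
        intro h0
        simp [h0] at ht
    refine ⟨_, hf, Continuous.memLp_of_hasCompactSupport ?_ hsupp, hsupp, ?_⟩
    · exact hF'cont.div (by fun_prop) fun t => by exact_mod_cast (hω.pos t).ne'
    · have h := hf.edist_toLp (mem_div hω.pos (Lp.memLp F))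
      rw [toLp_div hω.pos] at h
      rw [h, wnorm_sub_comm]
      refine le_trans (le_of_eq ?_) hle
      unfold wnorm
      congr 1
      funext t
      have : (ω t : ℂ) ≠ 0 := by exact_mod_cast (hω.pos t).ne'
      simp only [Pi.sub_apply]
      field_simp
  obtain ⟨F, hF⟩ := exists_forall_isOpen_exists_mem (A := lpTranslate hω.pos hadm) (S := S)
    (fun s _ => continuous_lpTranslate hω.pos hadm s) (by
      rintro U V hU hV ⟨F, hF⟩ ⟨H, hH⟩
      obtain ⟨ε, hε, hεU⟩ := EMetric.isOpen_iff.1 hU F hF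
      obtain ⟨δ, hδ, hδV⟩ := EMetric.isOpen_iff.1 hV H hH
      obtain ⟨f, hf, hfp, hfc, hfF⟩ := approx F (ENNReal.half_pos hε.ne')
      obtain ⟨g, hg, hgp, hgc, hgH⟩ := approx H (ENNReal.half_pos hδ.ne')
      obtain ⟨s, hs, h1, h2⟩ := exists_wnorm_leftTranslate_lt hω.pos hgrowth hS hfp hfc hgp hgc
        (lt_min (ENNReal.half_pos hε.ne') (ENNReal.half_pos hδ.ne'))
      have hsum := hf.add (hT (s := s⁻¹) hg)
      have htrans : leftTranslate s (f + leftTranslate s⁻¹ g) = leftTranslate s f + g := by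
        conv_rhs => rw [← leftTranslate_one g, ← mul_inv_cancel s, ← leftTranslate_leftTranslate]
        rfl
      refine ⟨s, hs, hsum.toLp, hεU ?_, hδV ?_⟩
      · refine (edist_triangle _ hf.toLp _).trans_lt ?_
        rw [Mem.edist_toLp, add_sub_cancel_left]
        calc _ < ε / 2 + ε / 2 := ENNReal.add_lt_add_of_lt_of_le
              (edist_ne_top _ _) (h2.trans_le (min_le_left _ _)) hfF
          _ = ε := ENNReal.add_halves ε
      · refine (edist_triangle _ hg.toLp _).trans_lt ?_
        rw [lpTranslate_toLp _ _ _ hsum (hT hsum), Mem.edist_toLp, htrans, add_sub_cancel_right]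
        calc _ < δ / 2 + δ / 2 := ENNReal.add_lt_add_of_lt_of_le
              (edist_ne_top _ _) (h1.trans_le (min_le_right _ _)) hgH
          _ = δ := ENNReal.add_halves δ)
  refine ⟨_, mem_div hω.pos (Lp.memLp F), fun g hg ε hε => ?_⟩
  obtain ⟨s, hs, h⟩ := hF (Metric.eball hg.toLp ε) Metric.isOpen_eball
    ⟨_, Metric.mem_eball_self hε⟩
  refine ⟨s, hs, ?_⟩
  rwa [← edist_lpTranslate_toLp hω.pos hadm s F hg]

end Sufficiency

/-! ### Dense vectors near a given element -/

section DenseVector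

variable {G : Type*} [CommGroup G] [MeasurableSpace G] {μ : Measure G} {p : ℝ≥0∞} {ω : G → ℝ}

/-- The translates of a dense vector are dense vectors, hence a dense vector can be taken
arbitrarily close to a given element. -/
lemma IsDenseVector.exists_close {S : Set G} {f : G → ℂ} (hf : IsDenseVector μ p ω S f)
    (hadm : IsAdmissible μ p ω univ) {g : G → ℂ} (hg : Mem μ p ω g) {ε : ℝ≥0∞} (hε : 0 < ε) :
    ∃ f', IsDenseVector μ p ω S f' ∧ wnorm μ p ω (f' - g) < ε := by
  obtain ⟨s, -, hs⟩ := hf.2 g hg ε hε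
  obtain ⟨C, hC⟩ := hadm s (mem_univ s)
  obtain ⟨D, hD⟩ := hadm s⁻¹ (mem_univ s⁻¹)
  refine ⟨_, ⟨(hC f hf.1).1, fun k hk η hη => ?_⟩, hs⟩
  have hk' := (hD k hk).1
  obtain ⟨n, hn, hlt⟩ := ENNReal.exists_nnreal_pos_mul_lt (a := C) ENNReal.coe_ne_top hη.ne'
  obtain ⟨t, ht, hlt'⟩ := hf.2 _ hk' n (by exact_mod_cast hn)
  refine ⟨t, ht, ?_⟩
  have hft : Mem μ p ω (leftTranslate t f) := by
    obtain ⟨E, hE⟩ := hadm t (mem_univ t)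
    exact (hE f hf.1).1
  have heq : leftTranslate t (leftTranslate s f) - k =
      leftTranslate s (leftTranslate t f - leftTranslate s⁻¹ k) := by
    rw [leftTranslate_sub, leftTranslate_leftTranslate, leftTranslate_leftTranslate,
      leftTranslate_leftTranslate, mul_inv_cancel, leftTranslate_one, mul_comm]
  rw [heq]
  refine ((hC _ (hft.sub hk')).2.trans ?_).trans_lt hlt
  rw [mul_comm]
  gcongr

end DenseVector

/-! ### A dense orbit forces small weights -/

section Necessity

open scoped Pointwise

variable {G : Type*} [CommGroup G] [TopologicalSpace G] [IsTopologicalGroup G]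
  [MeasurableSpace G] [BorelSpace G] {μ : Measure G} {p : ℝ≥0∞} {ω : G → ℝ}

/-- If `h` is close to `c` on `K`, and its translate by `r` is close to `d` on `K` and to `0` on
the disjoint set `r K`, then `ω r` is small. -/
lemma weight_mul_le [μ.IsHaarMeasure] (hp : 1 ≤ p) (hmeas : Measurable ω)
    (hpos : ∀ t, 0 < ω t) {K : Set G} (hKm : MeasurableSet K) (hK0 : μ K ≠ 0)
    {m M δ : ℝ} (hm : 0 < m) (hmK : ∀ t ∈ K, m ≤ ω t) (hM : 0 < M) (hδ : 0 ≤ δ) {r : G}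
    (hMr : ∀ u ∈ K, ω r ≤ M * ω (r * u)) (hr : ∀ u ∈ K, r * u ∉ K) {c d : ℂ} (hc : 1 ≤ ‖c‖)
    {h : G → ℂ} (hh : Mem μ p ω h)
    (h1 : wnorm μ p ω (leftTranslate r h - K.indicator fun _ => d) ≤ ENNReal.ofReal δ)
    (h2 : wnorm μ p ω (h - K.indicator fun _ => c) ≤ ENNReal.ofReal δ) :
    ω r * (μ K ^ (1 / p.toReal)).toReal ≤ M * δ + ω r * (m⁻¹ * δ) := by
  have hp0 : p ≠ 0 := (zero_lt_one.trans_le hp).ne'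
  have hhm : AEStronglyMeasurable h (μ.restrict K) :=
    (hh.aestronglyMeasurable hmeas hpos).restrict
  have hres : μ.restrict K ≠ 0 := by simpa using hK0
  have hκ : μ K ^ (1 / p.toReal) ≤ eLpNorm (fun _ : G => c) p (μ.restrict K) := by
    rw [eLpNorm_const _ hp0 hres, Measure.restrict_apply_univ]
    refine le_mul_of_one_le_left zero_le ?_
    rw [← ofReal_norm]
    simpa using ENNReal.ofReal_le_ofReal hc
  have htri : eLpNorm (fun _ : G => c) p (μ.restrict K) ≤
      eLpNorm h p (μ.restrict K) + eLpNorm (fun t => h t - c) p (μ.restrict K) := by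
    refine le_trans (le_of_eq ?_)
      (eLpNorm_sub_le hhm (hhm.sub aestronglyMeasurable_const) hp)
    congr 1
    funext t
    simp
  -- On `K` the weight is at least `m`, so dropping it costs a factor `m⁻¹`.
  have hclose : eLpNorm (fun t => h t - c) p (μ.restrict K) ≤ ENNReal.ofReal (m⁻¹ * δ) := by
    rw [ENNReal.ofReal_mul (by positivity)]
    refine le_trans ?_ (mul_le_mul_right ((eLpNorm_restrict_le _ p μ K).trans h2) _)
    refine eLpNorm_le_mul_eLpNorm_of_ae_le_mul ?_ p
    filter_upwards [ae_restrict_mem hKm] with t ht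
    have h3 := mul_le_mul_of_nonneg_left (hmK t ht) (norm_nonneg (h t - c))
    rw [← div_eq_inv_mul, le_div_iff₀ hm]
    simpa [ht, abs_of_pos (hpos t)] using h3
  -- After the substitution `t = r * u` with `u ∈ K`, the indicator vanishes and the weight `ω (r *
  -- u)` is at least `ω r / M`.
  have hsmall : eLpNorm h p (μ.restrict K) ≤ ENNReal.ofReal (M / ω r * δ) := by
    have hM' : 0 < M / ω r := div_pos hM (hpos r)
    rw [ENNReal.ofReal_mul hM'.le]
    have h3 := (measurableEmbedding_mulLeft r).eLpNorm_map_measure (μ := μ) (p := p)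
      (g := fun t => (leftTranslate r h - K.indicator fun _ => d) t * (ω t : ℂ))
    rw [map_mul_left_eq_self] at h3
    rw [wnorm, h3] at h1
    refine le_trans ?_ (mul_le_mul_right ((eLpNorm_restrict_le _ p μ K).trans h1) _)
    refine eLpNorm_le_mul_eLpNorm_of_ae_le_mul ?_ p
    filter_upwards [ae_restrict_mem hKm] with u hu
    have h4 := mul_le_mul_of_nonneg_left (hMr u hu) (norm_nonneg (h u))
    rw [div_mul_eq_mul_div, le_div_iff₀ (hpos r)]
    simp [leftTranslate, hr u hu, abs_of_pos (hpos (r * u))]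
    linarith
  have hfin : μ K ^ (1 / p.toReal) ≤ ENNReal.ofReal (M / ω r * δ + m⁻¹ * δ) := by
    have := hpos r
    rw [ENNReal.ofReal_add (by positivity) (by positivity)]
    exact hκ.trans (htri.trans (add_le_add hsmall hclose))
  have hreal := ENNReal.toReal_le_of_le_ofReal (by have := hpos r; positivity) hfin
  calc _ ≤ ω r * (M / ω r * δ + m⁻¹ * δ) := mul_le_mul_of_nonneg_left hreal (hpos r).le
    _ = _ := by
      have := (hpos r).ne'
      field_simp

theorem IsDenseVector.exists_weight_lt [T2Space G] [LocallyCompactSpace G]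
    [μ.IsHaarMeasure] (hp : 1 ≤ p)
    (hω : IsWeight μ p ω) (hcont : Continuous ω) (hadm : IsAdmissible μ p ω univ)
    {S : Set G} {f₀ : G → ℂ} (hf₀ : IsDenseVector μ p ω S f₀) {ε : ℝ} (hε : 0 < ε) :
    ∃ s ∈ S, ω s < ε ∧ ω s⁻¹ < ε := by
  obtain ⟨K, hK, hK1⟩ := exists_compact_mem_nhds (1 : G)
  have hKm : MeasurableSet K := hK.isClosed.measurableSet
  have hK0 : μ K ≠ 0 := (Measure.measure_pos_of_mem_nhds μ hK1).ne'
  have hp0 : p ≠ 0 := (zero_lt_one.trans_le hp).ne'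
  have hgrowth := fun (K : Set G) (hK : IsCompact K) => exists_forall_mem_mul_le hω.pos hcont
    (exists_forall_mul_le hp hω hcont hadm) hK
  have hT : ∀ {s : G} {f : G → ℂ}, Mem μ p ω f → Mem μ p ω (leftTranslate s f) := by
    intro s f hf
    exact ((hadm s (mem_univ s)).choose_spec f hf).1
  obtain ⟨t₀, ht₀, hmin⟩ := hK.exists_isMinOn ⟨1, mem_of_mem_nhds hK1⟩ hcont.continuousOn
  -- `M` serves through `r = u⁻¹ * (r * u)` with `u ∈ K`; `L` bounds `T_s` for every `s` with `s K`
  -- meeting `K`.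
  obtain ⟨M, hM, hMK⟩ := hgrowth K⁻¹ hK.inv
  obtain ⟨L, hL, hLK⟩ := hgrowth (K / K) (div_eq_mul_inv K K ▸ hK.mul hK.inv)
  have hMK' : ∀ r, ∀ u ∈ K, ω r ≤ M * ω (r * u) := fun r u hu => by
    simpa [mul_comm, mul_left_comm] using hMK u⁻¹ (by simpa using hu) (r * u)
  set m := ω t₀
  have hm : 0 < m := hω.pos t₀
  set κ := (μ K ^ (1 / p.toReal)).toReal
  have hκ : 0 < κ := by
    refine ENNReal.toReal_pos ?_ ?_
    · simp [hK0, hK.measure_lt_top.ne]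
    · exact ENNReal.rpow_ne_top_of_nonneg (by positivity) hK.measure_lt_top.ne
  have hφ : ∀ c : ℂ, Mem μ p ω (K.indicator fun _ => c) := hω.mem_indicator hK hKm
  set w := (wnorm μ p ω (K.indicator fun _ => 1)).toReal
  have hw_eq : wnorm μ p ω (K.indicator fun _ => 1) = ENNReal.ofReal w :=
    (ENNReal.ofReal_toReal (hφ 1).2.ne).symm
  have hw : 0 < w :=
    ENNReal.toReal_pos (hω.wnorm_indicator_ne_zero hp0 hK hKm hK0) (hφ 1).2.ne
  -- `m⁻¹ * δ ≤ κ / 2` absorbs the last term of `weight_mul_le` into its left side; the rest then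
  -- gives `ω r < ε`.
  obtain ⟨δ, hδ, hδ1, hδm, hδε⟩ : ∃ δ > 0, δ ≤ 1 ∧ m⁻¹ * δ ≤ κ / 2 ∧ M * δ < ε * (κ / 2) := by
    refine ⟨min 1 (min (m * (κ / 2)) (ε * (κ / 2) / (2 * M))), by positivity, min_le_left _ _,
      ?_, ?_⟩
    · rw [inv_mul_le_iff₀ hm]
      exact (min_le_right _ _).trans (min_le_left _ _)
    · have h : min 1 (min (m * (κ / 2)) (ε * (κ / 2) / (2 * M))) ≤ ε * (κ / 2) / (2 * M) :=
        (min_le_right _ _).trans (min_le_right _ _)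
      rw [le_div_iff₀ (by positivity)] at h
      have : 0 < ε * (κ / 2) := by positivity
      nlinarith
  have hδ' : 0 < ENNReal.ofReal δ := ENNReal.ofReal_pos.2 hδ
  have small : ∀ r, ω r * κ ≤ M * δ + ω r * (m⁻¹ * δ) → ω r < ε := fun r hr => by
    have h3 := mul_le_mul_of_nonneg_left hδm (hω.pos r).le
    have : ω r * (κ / 2) < ε * (κ / 2) := by linarith
    exact lt_of_mul_lt_mul_right this (by positivity)
  -- If `s ∈ K / K`, then `T_s f` has norm at most `L * (1 + w)`, so it cannot be within `1` of `c
  -- 1_K`, whose norm is `c * w`.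
  obtain ⟨c, hc1, hc⟩ : ∃ c : ℝ, 1 ≤ c ∧ 1 + L * (1 + w) < c * w := by
    refine ⟨(1 + L * (1 + w)) / w + 1, le_add_of_nonneg_left (by positivity), ?_⟩
    rw [add_mul, div_mul_cancel₀ _ hw.ne']
    linarith
  obtain ⟨f, hf, hf1⟩ := hf₀.exists_close hadm (hφ 1) hδ'
  obtain ⟨s, hs, hsc⟩ := hf.2 _ (hφ c) _ hδ'
  have hsK : s ∉ K / K := by
    intro hmem
    have h1 : wnorm μ p ω (K.indicator fun _ => (c : ℂ)) ≤
        ENNReal.ofReal δ + ENNReal.ofReal L * (ENNReal.ofReal δ + ENNReal.ofReal w) := by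
      calc wnorm μ p ω (K.indicator fun _ => (c : ℂ))
          = wnorm μ p ω (((K.indicator fun _ => (c : ℂ)) - leftTranslate s f) +
              leftTranslate s f) := by rw [sub_add_cancel]
        _ ≤ _ := wnorm_add_le hp ((hφ c).sub (hT hf.1)) (hT hf.1)
        _ ≤ _ := by
          gcongr
          · rw [wnorm_sub_comm]
            exact hsc.le
          · refine (wnorm_leftTranslate_le hω.pos (hLK s hmem) f).trans ?_
            gcongr
            calc wnorm μ p ω f
                = wnorm μ p ω ((f - K.indicator fun _ => 1) + K.indicator fun _ => 1) := by
                  rw [sub_add_cancel]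
              _ ≤ _ := wnorm_add_le hp (hf.1.sub (hφ 1)) (hφ 1)
              _ ≤ _ := by
                rw [hw_eq]
                gcongr
    rw [wnorm_indicator_const, hw_eq, ← ofReal_norm, Complex.norm_real,
      Real.norm_of_nonneg (by linarith), ← ENNReal.ofReal_mul (by linarith),
      ← ENNReal.ofReal_add hδ.le hw.le, ← ENNReal.ofReal_mul hL.le,
      ← ENNReal.ofReal_add hδ.le (by positivity),
      ENNReal.ofReal_le_ofReal_iff (by positivity)] at h1
    nlinarith
  refine ⟨s, hs, small s ?_, small s⁻¹ ?_⟩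
  · refine weight_mul_le hp hω.measurable hω.pos hKm hK0 hm (fun t ht => hmin ht) hM
      hδ.le (hMK' s) (fun u hu hsu => hsK ⟨s * u, hsu, u, hu, by simp⟩) (by simp) hf.1
      hsc.le hf1.le
  -- The roles are exchanged: `T_s f` is near `c` on `K`, and its translate by `s⁻¹` is `f`, near
  -- `1`.
  · refine weight_mul_le hp hω.measurable hω.pos hKm hK0 hm (fun t ht => hmin ht) hM
      hδ.le (hMK' s⁻¹) (fun u hu hsu => hsK ⟨u, hu, s⁻¹ * u, hsu, by simp⟩) (c := c) (d := 1)
      ?_ (hT (s := s) hf.1) ?_ hsc.le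
    · rwa [Complex.norm_real, Real.norm_of_nonneg (by linarith)]
    · rw [leftTranslate_leftTranslate, inv_mul_cancel, leftTranslate_one]
      exact hf1.le

end Necessity

/-- `IsGLB` respects the convention `inf ∅ = +∞`: in `ℝ` the empty set has no greatest lower bound,
so both sides fail for empty `S`. -/
lemma isGLB_image_max_iff {G : Type*} [Group G] {ω : G → ℝ} (hpos : ∀ t, 0 < ω t) {S : Set G} :
    IsGLB ((fun s : G => max (ω s) (ω s⁻¹)) '' S) 0 ↔
      ∀ ε > 0, ∃ s ∈ S, ω s < ε ∧ ω s⁻¹ < ε := by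
  refine ⟨fun h ε hε => ?_, fun h => ⟨?_, fun b hb => ?_⟩⟩
  · obtain ⟨_, ⟨s, hs, rfl⟩, hlt⟩ := (isGLB_lt_iff h).1 hε
    exact ⟨s, hs, max_lt_iff.1 hlt⟩
  · rintro _ ⟨s, -, rfl⟩
    exact (hpos s).le.trans (le_max_left _ _)
  · by_contra! hb0
    obtain ⟨s, hs, hlt⟩ := h b hb0
    exact (hb (mem_image_of_mem _ hs)).not_gt (max_lt_iff.2 hlt)

end WeightedLp

theorem mainTheorem7 {G : Type*} [CommGroup G] [TopologicalSpace G] [IsTopologicalGroup G]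
    [T2Space G] [LocallyCompactSpace G] [SecondCountableTopology G] [NoncompactSpace G]
    [MeasurableSpace G] [BorelSpace G] (μ : Measure G) [μ.IsHaarMeasure]
    (p : ℝ≥0∞) (hp_one : 1 ≤ p) (hp_top : p ≠ ∞)
    (ω : G → ℝ) (hω : WeightedLp.IsWeight μ p ω) (hω_cont : Continuous ω)
    (hω_adm : WeightedLp.IsAdmissible μ p ω Set.univ) (S : Set G) :
    (∃ f : G → ℂ, WeightedLp.IsDenseVector μ p ω S f) ↔
      IsGLB ((fun s : G => max (ω s) (ω s⁻¹)) '' S) 0 := by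
  rw [WeightedLp.isGLB_image_max_iff hω.pos]
  exact ⟨fun ⟨_, hf⟩ _ hε => hf.exists_weight_lt hp_one hω hω_cont hω_adm hε,
    WeightedLp.exists_isDenseVector hp_one hp_top hω hω_cont hω_adm⟩
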